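/- For $k\ge 2$ let $B_k$ be the Artin braid group on $k$ strings, that is, the group with generators $\sigma_1,\dots,\sigma_{k-1}$ and defining relations $\sigma_i\sigma_j=\sigma_j\sigma_i$ for $|i-j|\ge 2$ and $\sigma_i\sigma_{i+1}\sigma_i=\sigma_{i+1}\sigma_i\sigma_{i+1}$ for $1\le i\le k-2$. Let $\mathbf S(3)$ be the symmetric group on $\{1,2,3\}$. Let $\mu\colon B_3\to\mathbf S(3)$ be the homomorphism with $\mu(\sigma_1)=(1,2)$, $\mu(\sigma_2)=(2,3)$, let $\pi\colon B_4\to B_3$ be the homomorphism with $\pi(\sigma_1)=\pi(\sigma_3)=\sigma_1$, $\pi(\sigma_2)=\sigma_2$, and let $\mathbf T\subseteq B_4$ be the subgroup generated by $\sigma_2\sigma_3\sigma_1^{-1}\sigma_2^{-1}$ and $\sigma_3\sigma_1^{-1}$. A group homomorphism is called cyclic (respectively integral) if its image is a cyclic (respectively torsion free cyclic) group; the trivial homomorphism is both. Homomorphisms $\phi,\psi\colon G\to H$ are called conjugate if there is $h\in H$ with $\psi(g)=h\phi(g)h^{-1}$ for all $g\in G$. **Theorem 3.14.** (a) Every non-cyclic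 homomorphism $\psi\colon B_4\to\mathbf S(3)$ is conjugate to $\mu\circ\pi$. (b) Let $\phi\colon B_4\to B_3$ be a non-integral homomorphism. Then there is an injective homomorphism $\xi\colon B_3\to B_3$ such that $\phi=\xi\circ\pi$; moreover, if $\phi$ is surjective, then $\xi$ is an automorphism of $B_3$. Furthermore, $\operatorname{Ker}\phi=\mathbf T$. -/

import Mathlib

namespace ArtinBraid

/-- The relators of the canonical presentation of the Artin braid group on `k` strings. The
canonical generators `σ_1, …, σ_{k-1}` are indexed by `Fin (k - 1)`, so that the index `i`
(starting from `0`) stands for `σ_{i+1}`. -/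
def relators (k : ℕ) : Set (FreeGroup (Fin (k - 1))) :=
  {r | ∃ i j : Fin (k - 1), (i : ℕ) + 2 ≤ j ∧
      r = (FreeGroup.of i * FreeGroup.of j) * (FreeGroup.of j * FreeGroup.of i)⁻¹} ∪
  {r | ∃ i j : Fin (k - 1), (i : ℕ) + 1 = j ∧
      r = (FreeGroup.of i * FreeGroup.of j * FreeGroup.of i) *
        (FreeGroup.of j * FreeGroup.of i * FreeGroup.of j)⁻¹}

/-- The Artin braid group `B_k` on `k` strings, given by its canonical presentation. -/
abbrev BraidGroup (k : ℕ) : Type := PresentedGroup (relators k)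

/-- The canonical generators of `B_k`; `σ i` is `σ_{i+1}` in the usual numbering from `1`. -/
def σ {k : ℕ} (i : Fin (k - 1)) : BraidGroup k := PresentedGroup.of i

theorem σ_comm {k : ℕ} (i j : Fin (k - 1)) (h : (i : ℕ) + 2 ≤ j) :
    (σ i : BraidGroup k) * σ j = σ j * σ i := by
  have h1 := PresentedGroup.one_of_mem (rels := relators k) (Or.inl ⟨i, j, h, rfl⟩)
  rw [map_mul, map_inv, mul_inv_eq_one, map_mul, map_mul] at h1
  exact h1

theorem σ_braid {k : ℕ} (i j : Fin (k - 1)) (h : (i : ℕ) + 1 = j) :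
    (σ i : BraidGroup k) * σ j * σ i = σ j * σ i * σ j := by
  have h1 := PresentedGroup.one_of_mem (rels := relators k) (Or.inr ⟨i, j, h, rfl⟩)
  rw [map_mul, map_inv, mul_inv_eq_one, map_mul, map_mul, map_mul, map_mul] at h1
  exact h1

/-- The homomorphism `B_k → G` that sends the canonical generators to given elements of `G`
satisfying the commutation and braid relations. -/
def lift {k : ℕ} {G : Type*} [Group G] (f : Fin (k - 1) → G)
    (hcomm : ∀ i j : Fin (k - 1), (i : ℕ) + 2 ≤ j → f i * f j = f j * f i)
    (hbraid : ∀ i j : Fin (k - 1), (i : ℕ) + 1 = j → f i * f j * f i = f j * f i * f j) :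
    BraidGroup k →* G :=
  PresentedGroup.toGroup (f := f) (by
    rintro r (⟨i, j, h, rfl⟩ | ⟨i, j, h, rfl⟩)
    · simp only [map_mul, map_inv, FreeGroup.lift_apply_of]
      exact mul_inv_eq_one.mpr (hcomm i j h)
    · simp only [map_mul, map_inv, FreeGroup.lift_apply_of]
      exact mul_inv_eq_one.mpr (hbraid i j h))

@[simp] theorem lift_σ {k : ℕ} {G : Type*} [Group G] (f : Fin (k - 1) → G)
    (hcomm : ∀ i j : Fin (k - 1), (i : ℕ) + 2 ≤ j → f i * f j = f j * f i)
    (hbraid : ∀ i j : Fin (k - 1), (i : ℕ) + 1 = j → f i * f j * f i = f j * f i * f j)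
    (i : Fin (k - 1)) : lift f hcomm hbraid (σ i) = f i :=
  PresentedGroup.toGroup.of _

/-- The canonical epimorphism `μ : B_3 → S(3)`, `σ_1 ↦ (1 2)`, `σ_2 ↦ (2 3)`, where `S(3)` is
the group of permutations of the three-point set `Fin 3 = {0, 1, 2}`. -/
def μ : BraidGroup 3 →* Equiv.Perm (Fin 3) :=
  lift ![Equiv.swap 0 1, Equiv.swap 1 2] (by decide) (by decide)

/-- The canonical epimorphism `π : B_4 → B_3`, `σ_1 ↦ σ_1`, `σ_2 ↦ σ_2`, `σ_3 ↦ σ_1`. -/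
def π : BraidGroup 4 →* BraidGroup 3 :=
  lift ![σ 0, σ 1, σ 0]
    (by
      intro i j h
      fin_cases i <;> fin_cases j <;> simp at h ⊢)
    (by
      have hb : (σ 0 : BraidGroup 3) * σ 1 * σ 0 = σ 1 * σ 0 * σ 1 := σ_braid 0 1 rfl
      intro i j h
      fin_cases i <;> fin_cases j <;> first | exact absurd h (by decide) | exact hb | exact hb.symm)

/-- The subgroup `T` of `B_4` generated by `w = σ_2 σ_3 σ_1⁻¹ σ_2⁻¹` and `c_1 = σ_3 σ_1⁻¹`. -/
def T : Subgroup (BraidGroup 4) :=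
  Subgroup.closure {σ 1 * σ 2 * (σ 0)⁻¹ * (σ 1)⁻¹, σ 2 * (σ 0)⁻¹}

/-- A homomorphism is cyclic if its image is a cyclic group (possibly trivial). -/
def IsCyclicHom {G H : Type*} [Group G] [Group H] (φ : G →* H) : Prop :=
  IsCyclic φ.range

/-- A homomorphism is integral if its image is a torsion free cyclic group (possibly trivial). -/
def IsIntegralHom {G H : Type*} [Group G] [Group H] (φ : G →* H) : Prop :=
  IsCyclic φ.range ∧ ∀ x ∈ φ.range, IsOfFinOrder x → x = 1

/-- Two homomorphisms `φ, ψ : G → H` are conjugate if `ψ(g) = h φ(g) h⁻¹` for some `h ∈ H`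
and all `g ∈ G`. -/
def ConjHom {G H : Type*} [Group G] [Group H] (φ ψ : G →* H) : Prop :=
  ∃ h : H, ∀ g : G, ψ g = h * φ g * h⁻¹

end ArtinBraid

/-! Part (a) is a finite check. For (b), write `B_3` as F ⋊ ℤ with F free of rank two. Everything
rests on one fact (`FreeGroup.eq_one_of_conj`): in F, if `c` is conjugate to `w` and also to `c⁻¹ *
w`, then `c = 1`. Embed F in the matrices congruent to 1 mod 2. If `c` is 1 mod `2m`, conjugation
does not change it mod `4m`, so there `w = c` and `w = c²`. Thus `c` is 1 modulo every power of 2.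

For the images `a`, `b`, `c` of the generators of `B_4`, the element `c * a⁻¹` satisfies such a
system with conjugators in F. Hence `a = c`, and φ factors through π as ξ ∘ π (`eq_of_braid`).

If ξ separates the generators of `B_3`, its restriction to F is not trivial. That restriction is
injective or has cyclic image, and a quadratic form excludes the latter. The same fact shows that
the stable letter leaves F, so ξ is injective (`injective_of_ne_one`). If ξ does not separate them,
φ is cyclic, hence integral, because `B_3` is torsion free. Finally Ker φ = Ker π, which is the
normal subgroup `T`. -/

/-! ### Ping-pong for the Sanov subgroup -/

/-- With z = x + iy, failure of both would give |x| ≥ x² + y² > x² ≥ |x|. This yields the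
disjointness needed for ping-pong. -/
theorem abs_re_lt_one_or_abs_re_S_smul_lt_one (z : UpperHalfPlane) :
    |z.re| < 1 ∨ |(ModularGroup.S • z).re| < 1 := by
  by_contra! h
  obtain ⟨h1, h2⟩ := h
  have hr : (ModularGroup.S • z).re = -z.re / (z.re ^ 2 + z.im ^ 2) := by
    rw [UpperHalfPlane.modular_S_smul, UpperHalfPlane.mk_re, Complex.inv_re, Complex.normSq_neg,
      Complex.normSq_apply]
    simp [sq]
  have hp : 0 < z.re ^ 2 + z.im ^ 2 := by have := z.im_pos; positivity
  rw [hr, abs_div, abs_neg, abs_of_pos hp, le_div_iff₀ hp, one_mul, ← sq_abs z.re] at h2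
  nlinarith [pow_pos z.im_pos 2]

open scoped MatrixGroups in
/-- The homomorphism from the free group of rank two onto the Sanov subgroup of `SL(2, ℤ)`. -/
def sanov : FreeGroup (Fin 2) →* SL(2, ℤ) :=
  FreeGroup.lift ![ModularGroup.T ^ 2, ModularGroup.S⁻¹ * ModularGroup.T ^ 2 * ModularGroup.S]

open scoped MatrixGroups Pointwise UpperHalfPlane in
theorem sanov_injective : Function.Injective sanov := by
  -- In the coordinate `r i` the generator `a i` is translation by 2; it sends the complement of `r
  -- i < -1` into `1 ≤ r i`.
  let r : Fin 2 → ℍ → ℝ := ![fun z => z.re, fun z => (ModularGroup.S • z).re]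
  have hT : ∀ z : ℍ, (ModularGroup.T ^ 2 • z).re = 2 + z.re := fun z => by
    have := UpperHalfPlane.modular_T_zpow_smul z 2
    rw [zpow_ofNat] at this
    rw [this, UpperHalfPlane.vadd_re]
    norm_num
  set a : Fin 2 → SL(2, ℤ) :=
    ![ModularGroup.T ^ 2, ModularGroup.S⁻¹ * ModularGroup.T ^ 2 * ModularGroup.S] with ha
  have hra : ∀ i z, r i (a i • z) = 2 + r i z := by
    intro i z
    fin_cases i
    · exact hT z
    · simp only [r, ha, Fin.mk_one, Matrix.cons_val_one, Matrix.cons_val_fin_one]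
      rw [mul_smul, mul_smul, smul_inv_smul, hT]
  have hra' : ∀ i z, r i ((a i)⁻¹ • z) = r i z - 2 := fun i z => by
    have := hra i ((a i)⁻¹ • z)
    rw [smul_inv_smul] at this
    linarith
  have hd : ∀ i j z, i ≠ j → 1 ≤ |r i z| → ¬ 1 ≤ |r j z| := by
    intro i j z hij hi hj
    have := abs_re_lt_one_or_abs_re_S_smul_lt_one z
    fin_cases i <;> fin_cases j <;> simp_all [r] <;> grind
  have hle : ∀ x : ℝ, 1 ≤ x → 1 ≤ |x| := fun x h => h.trans (le_abs_self x)
  have hlt : ∀ x : ℝ, x < -1 → 1 ≤ |x| := fun x h => by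
    have := neg_abs_le x
    linarith
  refine FreeGroup.injective_lift_of_ping_pong a (fun i => {z | 1 ≤ r i z})
    (fun i => {z | r i z < -1}) ?_ ?_ ?_ ?_ ?_ ?_
  · intro i
    obtain ⟨n, hn⟩ := Archimedean.arch (1 - r i UpperHalfPlane.I) (zero_lt_two (α := ℝ))
    refine ⟨a i ^ n • UpperHalfPlane.I, ?_⟩
    have : ∀ m : ℕ, r i (a i ^ m • UpperHalfPlane.I) = m • (2 : ℝ) + r i UpperHalfPlane.I := by
      intro m
      induction m with
      | zero => simp
      | succ m ih => rw [pow_succ', mul_smul, hra, ih, succ_nsmul]; ring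
    rw [Set.mem_ofPred_eq, this]
    linarith
  · intro i j hij
    exact Set.disjoint_left.2 fun z h1 h2 => hd i j z hij (hle _ h1) (hle _ h2)
  · intro i j hij
    exact Set.disjoint_left.2 fun z h1 h2 => hd i j z hij (hlt _ h1) (hlt _ h2)
  · intro i j
    refine Set.disjoint_left.2 fun z h1 h2 => ?_
    by_cases hij : i = j
    · subst hij
      have h1 : 1 ≤ r i z := h1
      have h2 : r i z < -1 := h2
      linarith
    · exact hd i j z hij (hle _ h1) (hlt _ h2)
  · rintro i _ ⟨z, hz, rfl⟩
    have hz : ¬ r i z < -1 := hz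
    change 1 ≤ r i (a i • z)
    rw [hra]
    linarith
  · rintro i _ ⟨z, hz, rfl⟩
    have hz : ¬ 1 ≤ r i z := hz
    change r i ((a i)⁻¹ • z) < -1
    rw [hra']
    linarith

/-! ### Congruences modulo powers of 2 -/

theorem Matrix.intCast_one_apply {ι R : Type*} [DecidableEq ι] [Ring R] (i j : ι) :
    (((1 : Matrix ι ι ℤ) i j : ℤ) : R) = (1 : Matrix ι ι R) i j := by
  rw [Matrix.one_apply, Matrix.one_apply]
  split_ifs <;> simp

theorem exists_sanov_eq_one_add_two_smul (x : FreeGroup (Fin 2)) :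
    ∃ X : Matrix (Fin 2) (Fin 2) ℤ, (sanov x).1 = 1 + (2 : ℤ) • X := by
  have h : (Matrix.SpecialLinearGroup.map (Int.castRingHom (ZMod 2))).comp sanov = 1 := by
    refine FreeGroup.ext_hom _ _ fun i => ?_
    fin_cases i <;> simp [sanov] <;> decide
  have h2 := congrArg Subtype.val (DFunLike.congr_fun h x)
  have h3 : ∀ i j, ∃ k, (sanov x).1 i j - (1 : Matrix (Fin 2) (Fin 2) ℤ) i j = 2 * k := by
    intro i j
    have h4 := congrFun (congrFun h2 i) j
    refine (ZMod.intCast_zmod_eq_zero_iff_dvd _ 2).1 ?_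
    rw [Int.cast_sub, sub_eq_zero]
    refine Eq.trans h4 ?_
    exact (Matrix.intCast_one_apply i j).symm
  choose X hX using h3
  refine ⟨Matrix.of X, ?_⟩
  ext i j
  have := hX i j
  simp only [Matrix.add_apply, Matrix.smul_apply, Matrix.of_apply, smul_eq_mul]
  linarith

/-- The congruence step: if `c` is congruent to `1` modulo `2 m`, then it is so modulo `4 m`. -/
theorem Matrix.exists_eq_one_add_smul_of_conj {ι : Type*} [Fintype ι] [DecidableEq ι]
    {P Q C W Y : Matrix ι ι ℤ} {m : ℤ} (hm : m ≠ 0) (hP : ∃ X, P = 1 + (2 : ℤ) • X)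
    (hQ : ∃ X, Q = 1 + (2 : ℤ) • X) (hW : ∃ Z, W = 1 + (2 * m) • Z)
    (hC : C = 1 + (2 * m) • Y) (h1 : P * C = W * P) (h2 : C * Q * C = W * Q) :
    ∃ Z, C = 1 + (2 * (2 * m)) • Z := by
  obtain ⟨X, rfl⟩ := hP
  obtain ⟨X', rfl⟩ := hQ
  obtain ⟨Z, rfl⟩ := hW
  subst hC
  -- After cancelling `2 * m`, `e1` gives Y ≡ Z mod 2 and `e2` gives Z ≡ 0 mod 2, so Y is even; the
  -- witness below is half of it.
  have e1 : (2 * m) • (Y + (2 : ℤ) • (X * Y)) = (2 * m) • (Z + (2 : ℤ) • (Z * X)) := by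
    have : (1 + (2 : ℤ) • X) * (1 + (2 * m) • Y) - (1 + (2 * m) • Z) * (1 + (2 : ℤ) • X) = 0 :=
      sub_eq_zero.2 h1
    rw [← sub_eq_zero, ← this]
    simp only [mul_add, add_mul, one_mul, mul_one, smul_mul_assoc, mul_smul_comm, smul_add]
    module
  have e2 : (2 * m) • ((2 : ℤ) • Y + (2 : ℤ) • (X' * Y + Y * X') + (2 * m) • (Y * Y) +
      (2 * (2 * m)) • (Y * X' * Y)) = (2 * m) • (Z + (2 : ℤ) • (Z * X')) := by
    have := sub_eq_zero.2 h2
    rw [← sub_eq_zero, ← this]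
    simp only [mul_add, add_mul, one_mul, mul_one, smul_mul_assoc, mul_smul_comm, smul_add]
    module
  have h2m : (2 * m) ≠ 0 := by simpa using hm
  have e1' := smul_right_injective _ h2m e1
  have e2' := smul_right_injective _ h2m e2
  refine ⟨Z * X - X * Y + (Y + X' * Y + Y * X' + m • (Y * Y) + (2 * m) • (Y * X' * Y)
    - Z * X'), ?_⟩
  have hZ : Z = (2 : ℤ) • Y + (2 : ℤ) • (X' * Y + Y * X') + (2 * m) • (Y * Y) +
      (2 * (2 * m)) • (Y * X' * Y) - (2 : ℤ) • (Z * X') := eq_sub_of_add_eq e2'.symm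
  have hY : Y = Z + (2 : ℤ) • (Z * X) - (2 : ℤ) • (X * Y) := eq_sub_of_add_eq e1'
  have hY2 : Y = (2 : ℤ) • (Z * X - X * Y + (Y + X' * Y + Y * X' + m • (Y * Y) +
      (2 * m) • (Y * X' * Y) - Z * X')) := by
    refine hY.trans ?_
    rw [add_sub_assoc]
    refine (congrArg (· + _) hZ).trans ?_
    module
  rw [mul_comm 2 (2 * m), mul_smul (2 * m) (2 : ℤ), ← hY2]

theorem FreeGroup.eq_one_of_conj {p q c w : FreeGroup (Fin 2)} (h1 : p * c * p⁻¹ = w)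
    (h2 : q * c * q⁻¹ = c⁻¹ * w) : c = 1 := by
  have h1' : p * c = w * p := by rw [← h1]; group
  have h2' : c * q * c = w * q := by
    have : q * c = c⁻¹ * w * q := by rw [← h2]; group
    rw [mul_assoc, this]; group
  have hc : ∀ n : ℕ, ∃ Y, (sanov c).1 = 1 + (2 * 2 ^ n : ℤ) • Y := by
    intro n
    induction n with
    | zero => simpa using exists_sanov_eq_one_add_two_smul c
    | succ n ih =>
      obtain ⟨Y, hY⟩ := ih
      have hW : (sanov w).1 = 1 + (2 * 2 ^ n : ℤ) • ((sanov p).1 * Y * (sanov p⁻¹).1) := by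
        have hpp : (sanov p).1 * (sanov p⁻¹).1 = 1 := by
          refine (congrArg Subtype.val (_root_.map_mul sanov p p⁻¹).symm).trans ?_
          rw [mul_inv_cancel, _root_.map_one]
          rfl
        rw [← h1, _root_.map_mul, _root_.map_mul]
        change (sanov p).1 * (sanov c).1 * (sanov p⁻¹).1 = _
        rw [hY, mul_add, mul_one, add_mul, hpp, mul_smul_comm, smul_mul_assoc]
      rw [pow_succ']
      exact Matrix.exists_eq_one_add_smul_of_conj (by positivity)
        (exists_sanov_eq_one_add_two_smul p) (exists_sanov_eq_one_add_two_smul q) ⟨_, hW⟩ hY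
        (congrArg Subtype.val (show sanov p * sanov c = sanov w * sanov p by
          rw [← _root_.map_mul, h1', _root_.map_mul]))
        (congrArg Subtype.val (show sanov c * sanov q * sanov c = sanov w * sanov q by
          rw [← _root_.map_mul, ← _root_.map_mul, h2', _root_.map_mul]))
  refine sanov_injective (Matrix.SpecialLinearGroup.ext _ _ fun i j => ?_)
  rw [_root_.map_one]
  change (sanov c).1 i j = (1 : Matrix (Fin 2) (Fin 2) ℤ) i j
  -- The exponent is the size of the entry itself, so the modulus exceeds that entry.
  refine sub_eq_zero.1 (Int.eq_zero_of_abs_lt_dvd (m := 2 * 2 ^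
    ((sanov c).1 i j - (1 : Matrix (Fin 2) (Fin 2) ℤ) i j).natAbs) ?_ ?_)
  · obtain ⟨Y, hY⟩ := hc ((sanov c).1 i j - (1 : Matrix (Fin 2) (Fin 2) ℤ) i j).natAbs
    refine ⟨Y i j, ?_⟩
    have := congrFun (congrFun hY i) j
    rw [Matrix.add_apply, Matrix.smul_apply, smul_eq_mul] at this
    linarith
  · set d := (sanov c).1 i j - (1 : Matrix (Fin 2) (Fin 2) ℤ) i j
    have h : d.natAbs < 2 ^ d.natAbs := Nat.lt_two_pow_self
    zify at h
    linarith [abs_nonneg d]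

/-! ### Residual finiteness and homomorphisms between free groups -/

open scoped MatrixGroups in
theorem FreeGroup.exists_sanov_mod_ne_one {x : FreeGroup (Fin 2)} (hx : x ≠ 1) :
    ∃ n : ℕ, Matrix.SpecialLinearGroup.map (Int.castRingHom (ZMod (n + 1))) (sanov x) ≠ 1 := by
  by_contra! h
  refine hx (sanov_injective (Matrix.SpecialLinearGroup.ext _ _ fun i j => ?_))
  rw [_root_.map_one]
  change (sanov x).1 i j = (1 : Matrix (Fin 2) (Fin 2) ℤ) i j
  set d := (sanov x).1 i j - (1 : Matrix (Fin 2) (Fin 2) ℤ) i j with hd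
  refine sub_eq_zero.1 (Int.eq_zero_of_abs_lt_dvd (m := ((d.natAbs + 1 : ℕ) : ℤ)) ?_ ?_)
  · refine (ZMod.intCast_zmod_eq_zero_iff_dvd _ _).1 ?_
    have := congrFun (congrFun (congrArg Subtype.val (h d.natAbs)) i) j
    rw [hd, Int.cast_sub, sub_eq_zero]
    refine Eq.trans this ?_
    exact (Matrix.intCast_one_apply i j).symm
  · push_cast
    rw [← hd]
    linarith

/-- A homomorphism out of the free group of rank two onto a free group is injective or has cyclic
image. -/
theorem FreeGroup.injective_or_isCyclic_of_surjective {X : Type*}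
    (f : FreeGroup (Fin 2) →* FreeGroup X) (hf : Function.Surjective f) :
    Function.Injective f ∨ IsCyclic (FreeGroup X) := by
  -- Precomposition with the surjection `f` embeds Hom(F(X), Q) = Q^X in Q². Taking Q of order 2
  -- bounds the rank of the image by 2.
  have hinj : ∀ (Q : Type) [Group Q], Function.Injective
      (fun g : X → Q => FreeGroup.lift.symm ((FreeGroup.lift g).comp f)) := by
    intro Q _ g g' h
    exact FreeGroup.lift.injective
      ((MonoidHom.cancel_right hf).1 (FreeGroup.lift.symm.injective h))
  have hfin : Finite X := by
    have : Finite (X → Multiplicative (ZMod 2)) := Finite.of_injective _ (hinj _)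
    classical
    refine Finite.of_injective (fun x : X => Pi.mulSingle (M := fun _ => Multiplicative (ZMod 2)) x
      (Multiplicative.ofAdd 1)) fun x y h => ?_
    by_contra hxy
    have := congrFun h x
    simp only [Pi.mulSingle_eq_same, Pi.mulSingle_eq_of_ne hxy] at this
    revert this
    decide
  have hcard : Nat.card X ≤ 2 := by
    have := Nat.card_le_card_of_injective _ (hinj (Multiplicative (ZMod 2)))
    rw [Nat.card_fun, Nat.card_fun, Nat.card_fin] at this
    have h2 : Nat.card (Multiplicative (ZMod 2)) = 2 := Nat.card_zmod 2
    rw [h2] at this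
    exact (Nat.pow_le_pow_iff_right one_lt_two).1 this
  rcases Nat.lt_or_ge (Nat.card X) 2 with hlt | hge
  · right
    have : Subsingleton X := Finite.card_le_one_iff_subsingleton.1 (by omega)
    rcases isEmpty_or_nonempty X with hX | ⟨⟨x⟩⟩
    · infer_instance
    · have : Unique X := ⟨⟨x⟩, fun y => Subsingleton.elim _ _⟩
      infer_instance
  · left
    rw [injective_iff_map_eq_one]
    intro x hx
    by_contra hne
    obtain ⟨n, hn⟩ := FreeGroup.exists_sanov_mod_ne_one hne
    let Q := Matrix.SpecialLinearGroup (Fin 2) (ZMod (n + 1))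
    -- In rank 2 the embedding joins finite sets of equal size, so every homomorphism to Q factors
    -- through `f` and kills `x`.
    have hbij := (Nat.bijective_iff_injective_and_card
      (fun g : X → Q => FreeGroup.lift.symm ((FreeGroup.lift g).comp f))).2
        ⟨hinj Q, by rw [Nat.card_fun, Nat.card_fun, Nat.card_fin, le_antisymm hcard hge]⟩
    obtain ⟨g, hg⟩ := hbij.2 (FreeGroup.lift.symm
      ((Matrix.SpecialLinearGroup.map (Int.castRingHom (ZMod (n + 1)))).comp sanov))
    have hg' := DFunLike.congr_fun (FreeGroup.lift.symm.injective hg) x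
    rw [MonoidHom.comp_apply, hx, _root_.map_one] at hg'
    exact hn hg'.symm

/-- A homomorphism from the free group of rank two to a free group is injective or has cyclic
image. -/
theorem FreeGroup.injective_or_isCyclic_range {α : Type} (f : FreeGroup (Fin 2) →* FreeGroup α) :
    Function.Injective f ∨ IsCyclic f.range := by
  let e := IsFreeGroup.toFreeGroup f.range
  rcases FreeGroup.injective_or_isCyclic_of_surjective (e.toMonoidHom.comp f.rangeRestrict)
    (e.surjective.comp f.rangeRestrict_surjective) with h | h
  · left
    intro x y hxy
    refine h (congrArg e (Subtype.ext hxy))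
  · right
    exact e.isCyclic.2 h

/-! ### Word identities for the generators of `T` -/

section GroupWords

variable {G : Type*} [Group G] {a b c : G}

theorem braid_inv (hab : a * b * a = b * a * b) : a⁻¹ * b⁻¹ * a⁻¹ = b⁻¹ * a⁻¹ * b⁻¹ := by
  simpa [mul_assoc] using congrArg (·⁻¹) hab

theorem inv_mul_mul_eq_of_braid (hab : a * b * a = b * a * b) : b⁻¹ * a * b = a * b * a⁻¹ := by
  rw [eq_mul_inv_iff_mul_eq, mul_assoc, mul_assoc, inv_mul_eq_iff_eq_mul]
  simpa only [mul_assoc] using hab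

theorem braid_conj_left (hac : a * c = c * a) :
    (b * a⁻¹) * (c * a⁻¹) * (b * a⁻¹)⁻¹ = b * c * a⁻¹ * b⁻¹ := by
  have h : a⁻¹ * c = c * a⁻¹ := (Commute.inv_left (show Commute a c from hac)).eq
  rw [show (b * a⁻¹) * (c * a⁻¹) * (b * a⁻¹)⁻¹ = b * (a⁻¹ * c) * b⁻¹ by group, h]
  group

theorem braid_conj_fst (hab : a * b * a = b * a * b) (hbc : b * c * b = c * b * c) :
    a * (b * c * a⁻¹ * b⁻¹) * a⁻¹ = (c * a⁻¹)⁻¹ * (b * c * a⁻¹ * b⁻¹) :=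
  calc
    _ = a * (b * c) * (a⁻¹ * b⁻¹ * a⁻¹) := by group
    _ = a * (b * c * b⁻¹) * a⁻¹ * b⁻¹ := by rw [braid_inv hab]; group
    _ = _ := by rw [← inv_mul_mul_eq_of_braid hbc]; group

theorem braid_conj_snd (hac : a * c = c * a) (hab : a * b * a = b * a * b)
    (hbc : b * c * b = c * b * c) :
    b * (b * c * a⁻¹ * b⁻¹) * b⁻¹ =
      (b * c * a⁻¹ * b⁻¹) * (c * a⁻¹)⁻¹ * (b * c * a⁻¹ * b⁻¹) := by
  have h : a⁻¹ * c = c * a⁻¹ := (Commute.inv_left (show Commute a c from hac)).eq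
  have h1 : a⁻¹ * b⁻¹ * a = b * a⁻¹ * b⁻¹ := by
    simpa [mul_assoc] using congrArg (·⁻¹) (inv_mul_mul_eq_of_braid hab.symm)
  symm
  calc
    _ = b * c * (a⁻¹ * b⁻¹ * a) * (c⁻¹ * b * c) * a⁻¹ * b⁻¹ := by group
    _ = b * c * b * (a⁻¹ * c) * b⁻¹ * a⁻¹ * b⁻¹ := by
      rw [h1, inv_mul_mul_eq_of_braid hbc]; group
    _ = b * (c * b * c) * (a⁻¹ * b⁻¹ * a⁻¹) * b⁻¹ := by rw [h]; group
    _ = _ := by rw [← hbc, braid_inv hab]; group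

end GroupWords

/-! ### `B_3` as a semidirect product -/

namespace ArtinBraid

/-- The action of a generator of `ℤ` on the free group of rank two, which is induced by
conjugation by `σ 0` on the commutator subgroup of `B_3`. -/
def rot : MulAut (FreeGroup (Fin 2)) :=
  MonoidHom.toMulEquiv
    (FreeGroup.lift ![FreeGroup.of 1, (FreeGroup.of 0)⁻¹ * FreeGroup.of 1])
    (FreeGroup.lift ![FreeGroup.of 0 * (FreeGroup.of 1)⁻¹, FreeGroup.of 0])
    (by ext i; fin_cases i <;> simp)
    (by ext i; fin_cases i <;> simp)

@[simp] theorem rot_of_zero : rot (FreeGroup.of 0) = FreeGroup.of 1 := by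
  simp [rot, MonoidHom.toMulEquiv]

@[simp] theorem rot_of_one : rot (FreeGroup.of 1) = (FreeGroup.of 0)⁻¹ * FreeGroup.of 1 := by
  simp [rot, MonoidHom.toMulEquiv]

/-- A semidirect product of the free group of rank two and `ℤ`, isomorphic to `B_3`. -/
abbrev FreeByInt : Type := FreeGroup (Fin 2) ⋊[zpowersHom _ rot] Multiplicative ℤ

namespace FreeByInt

open SemidirectProduct

/-- The stable letter. -/
def t : FreeByInt := inr (Multiplicative.ofAdd 1)

theorem t_mul_inl (x : FreeGroup (Fin 2)) : t * inl x = inl (rot x) * t := by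
  ext <;> simp [t]

theorem t_conj_inl (x : FreeGroup (Fin 2)) : t * inl x * t⁻¹ = inl (rot x) := by
  rw [t_mul_inl, mul_inv_cancel_right]

end FreeByInt

open FreeByInt SemidirectProduct

theorem σ_three : (σ 0 : BraidGroup 3) * σ 1 * σ 0 = σ 1 * σ 0 * σ 1 := σ_braid 0 1 rfl

/-- A homomorphism on `B_3` is given by two elements satisfying the braid relation. -/
def liftThree {G : Type*} [Group G] (a b : G) (h : a * b * a = b * a * b) : BraidGroup 3 →* G :=
  lift ![a, b] (fun i j hij => by have := i.2; have := j.2; omega) (fun i j hij => by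
    fin_cases i <;> fin_cases j <;> first | exact h | exact absurd hij (by decide))

section

variable {G : Type*} [Group G] (a b : G) (h : a * b * a = b * a * b)

@[simp] theorem liftThree_zero : liftThree a b h (σ 0) = a := lift_σ _ _ _ _

@[simp] theorem liftThree_one : liftThree a b h (σ 1) = b := lift_σ _ _ _ _

end

theorem hom_ext_three {G : Type*} [Group G] {f g : BraidGroup 3 →* G}
    (h0 : f (σ 0) = g (σ 0)) (h1 : f (σ 1) = g (σ 1)) : f = g :=
  PresentedGroup.ext fun i => by fin_cases i; exacts [h0, h1]

theorem hom_ext_four {G : Type*} [Group G] {f g : BraidGroup 4 →* G}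
    (h0 : f (σ 0) = g (σ 0)) (h1 : f (σ 1) = g (σ 1)) (h2 : f (σ 2) = g (σ 2)) : f = g :=
  PresentedGroup.ext fun i => by fin_cases i; exacts [h0, h1, h2]

def toFreeByInt : BraidGroup 3 →* FreeByInt :=
  liftThree t (inl (FreeGroup.of 0) * t) (by
    rw [← mul_assoc, t_mul_inl, mul_assoc _ t (_ * t), ← mul_assoc t, t_mul_inl]
    simp only [mul_assoc]
    rw [← mul_assoc t (inl _), t_mul_inl]
    simp only [rot_of_zero, rot_of_one, map_mul, map_inv, mul_assoc, mul_inv_cancel_left])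

/-- The second free generator goes to the conjugate by `σ 0` of the image of the first. -/
def ofFreeByInt : FreeByInt →* BraidGroup 3 :=
  SemidirectProduct.lift
    (FreeGroup.lift ![σ 1 * (σ 0)⁻¹, σ 0 * σ 1 * (σ 0)⁻¹ * (σ 0)⁻¹])
    (zpowersHom _ (σ 0)) (by
      set f : FreeGroup (Fin 2) →* BraidGroup 3 :=
        FreeGroup.lift ![σ 1 * (σ 0)⁻¹, σ 0 * σ 1 * (σ 0)⁻¹ * (σ 0)⁻¹] with hf
      have h1 : ∀ x, f (rot x) = σ 0 * f x * (σ 0)⁻¹ := by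
        refine DFunLike.congr_fun (f := f.comp rot.toMonoidHom)
          (g := (MulAut.conj (σ 0)).toMonoidHom.comp f) (FreeGroup.ext_hom _ _ fun i => ?_)
        fin_cases i
        · simp [hf, mul_assoc]
        · simp [hf, mul_assoc]
          simp only [← mul_assoc]
          rw [inv_mul_mul_eq_of_braid σ_three]
      have h2 : ∀ (n : ℤ) x, f ((rot ^ n) x) = σ 0 ^ n * f x * (σ 0 ^ n)⁻¹ := by
        intro n
        induction n with
        | zero => simp
        | succ n ih =>
          intro x
          rw [zpow_add_one, MulAut.mul_apply, ih, h1, zpow_add_one]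
          group
        | pred n ih =>
          intro x
          have := h1 (rot⁻¹ x)
          rw [MulAut.apply_inv_self] at this
          rw [zpow_sub_one, MulAut.mul_apply, ih, zpow_sub_one, this]
          group
      intro g
      ext1 x
      exact h2 g.toAdd _)

/-- The braid group `B_3` is a semidirect product of the free group of rank two and `ℤ`. -/
def equivFreeByInt : BraidGroup 3 ≃* FreeByInt :=
  MonoidHom.toMulEquiv toFreeByInt ofFreeByInt
    (hom_ext_three
      (by simp [toFreeByInt, ofFreeByInt, t])
      (by simp [toFreeByInt, ofFreeByInt, t]))
    (SemidirectProduct.hom_ext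
      (FreeGroup.ext_hom _ _ fun i => by
        fin_cases i
        · simp [toFreeByInt, ofFreeByInt]
        · simp [toFreeByInt, ofFreeByInt, ← mul_assoc, t_conj_inl])
      (MonoidHom.ext_mint (by simp [toFreeByInt, ofFreeByInt, t])))

@[simp] theorem equivFreeByInt_zero : equivFreeByInt (σ 0) = t := by
  change toFreeByInt (σ 0) = t
  simp [toFreeByInt]

@[simp] theorem equivFreeByInt_one : equivFreeByInt (σ 1) = inl (FreeGroup.of 0) * t := by
  change toFreeByInt (σ 1) = _
  simp [toFreeByInt]

end ArtinBraid

/-! ### Rigidity of the semidirect product -/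

namespace ArtinBraid

namespace FreeByInt

open SemidirectProduct

theorem eq_one_of_isOfFinOrder {x : FreeByInt} (h : IsOfFinOrder x) : x = 1 := by
  obtain ⟨n, hn, hxn⟩ := isOfFinOrder_iff_pow_eq_one.1 h
  have hr : x.right = 1 := by
    have := congrArg rightHom hxn
    rw [map_pow, map_one] at this
    exact (pow_eq_one_iff_left hn.ne').1 this
  have hl : inl x.left = x := by
    conv_rhs => rw [← inl_left_mul_inr_right x, hr, map_one, mul_one]
  rw [← hl, ← map_pow, ← map_one inl, inl_inj,
    pow_eq_one_iff_left hn.ne'] at hxn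
  rw [← hl, hxn, map_one]

theorem exists_inl_eq {x : FreeByInt} (hx : x.right = 1) : ∃ n, inl n = x :=
  ⟨x.left, by ext <;> simp [hx]⟩

theorem right_eq_of_braid {a b : FreeByInt} (h : a * b * a = b * a * b) : a.right = b.right := by
  have := congrArg rightHom h
  simp only [map_mul, rightHom_eq_right] at this
  rwa [mul_comm b.right a.right, mul_left_cancel_iff] at this

theorem eq_one_of_conj {p q c w : FreeByInt} (hp : p.right = 1) (hq : q.right = 1)
    (hc : c.right = 1) (h1 : p * c * p⁻¹ = w) (h2 : q * c * q⁻¹ = c⁻¹ * w) : c = 1 := by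
  obtain ⟨p, rfl⟩ := exists_inl_eq hp
  obtain ⟨q, rfl⟩ := exists_inl_eq hq
  obtain ⟨c, rfl⟩ := exists_inl_eq hc
  subst h1
  simp only [← map_mul, ← map_inv, inl_inj] at h2
  rw [FreeGroup.eq_one_of_conj rfl h2, map_one]

/-- In `FreeByInt`, the outer two of three elements satisfying the relations of `B_4` agree. -/
theorem eq_of_braid {a b c : FreeByInt} (hac : a * c = c * a) (hab : a * b * a = b * a * b)
    (hbc : b * c * b = c * b * c) : a = c := by
  have h1 := right_eq_of_braid hab
  have h2 := right_eq_of_braid hbc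
  have hc : c * a⁻¹ = 1 := by
    -- Since `a` commutes with `c * a⁻¹`, inserting powers of `a` on the right of a conjugator is
    -- harmless; they bring `b` and `a * b` into the free group.
    refine eq_one_of_conj (p := b * a⁻¹) (q := a * b * a⁻¹ * a⁻¹) ?_ ?_ ?_
      (braid_conj_left hac) ((Eq.trans ?_ (braid_conj_fst hab hbc)))
    · simp [h1]
    · simp [h1]
    · simp [h1, h2]
    · have h : a⁻¹ * c = c * a⁻¹ := (Commute.inv_left (show Commute a c from hac)).eq
      calc
        _ = a * b * a⁻¹ * (a⁻¹ * c) * a * b⁻¹ * a⁻¹ := by group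
        _ = a * b * (a⁻¹ * c) * b⁻¹ * a⁻¹ := by nth_rw 1 [h]; group
        _ = _ := by rw [h]; simp only [mul_assoc]
  exact (mul_inv_eq_one.1 hc).symm

/-- Conjugating `d ^ (i * j)` in two ways gives i² - ij + j² = 0, a definite form. -/
theorem eq_zero_of_conj_zpow {a : FreeByInt} {d : FreeGroup (Fin 2)} (hd : d ≠ 1) {i j : ℤ}
    (h1 : a * inl d ^ i * a⁻¹ = inl d ^ j) (h2 : a * inl d ^ j * a⁻¹ = inl d ^ (j - i)) :
    i = 0 := by
  have h : (inl d : FreeByInt) ^ (j * j) = inl d ^ ((j - i) * i) := by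
    rw [zpow_mul, ← h1, conj_zpow, ← zpow_mul, mul_comm i j, zpow_mul, ← conj_zpow, h2, zpow_mul]
  rw [← mul_inv_eq_one, ← zpow_neg, ← zpow_add, ← map_zpow, ← map_one inl, inl_inj,
    IsMulTorsionFree.zpow_eq_one_iff_right hd] at h
  nlinarith [sq_nonneg i, sq_nonneg (2 * j - i)]

/-- Every endomorphism of `FreeByInt` restricts to an endomorphism of the free group. -/
theorem exists_restrict (θ : FreeByInt →* FreeByInt) :
    ∃ f : FreeGroup (Fin 2) →* FreeGroup (Fin 2), ∀ x, θ (inl x) = inl (f x) := by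
  -- Conjugation by `t` is invisible in ℤ, so the images u, v of the two generators there satisfy u
  -- = v and v = u⁻¹v.
  have h0 : rightHom (θ (inl (FreeGroup.of 1))) = rightHom (θ (inl (FreeGroup.of 0))) := by
    rw [← rot_of_zero, ← t_conj_inl]
    simp
  have h1 : rightHom (θ (inl (FreeGroup.of 0))) = 1 := by
    have := congrArg (fun x => rightHom (θ x)) (t_conj_inl (FreeGroup.of 1))
    simpa [h0] using this
  let f : FreeGroup (Fin 2) →* FreeGroup (Fin 2) :=
    FreeGroup.lift fun i => (θ (inl (FreeGroup.of i))).left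
  refine ⟨f, DFunLike.congr_fun (f := θ.comp inl) (g := inl.comp f)
    (FreeGroup.ext_hom _ _ fun i => ?_)⟩
  have hi : (θ (inl (FreeGroup.of i))).right = 1 := by
    fin_cases i
    · exact h1
    · exact h0.trans h1
  ext
  · simp [f]
  · simp [hi]

theorem injective_of_ne_one (θ : FreeByInt →* FreeByInt) (h : θ (inl (FreeGroup.of 0)) ≠ 1) :
    Function.Injective θ := by
  obtain ⟨f, hf⟩ := exists_restrict θ
  have hU : θ t * inl (f (FreeGroup.of 0)) * (θ t)⁻¹ = inl (f (FreeGroup.of 1)) := by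
    rw [← hf, ← hf, ← map_mul, ← map_inv, ← map_mul, t_conj_inl, rot_of_zero]
  have hV : θ t * inl (f (FreeGroup.of 1)) * (θ t)⁻¹ =
      (inl (f (FreeGroup.of 0)))⁻¹ * inl (f (FreeGroup.of 1)) := by
    rw [← hf, ← hf, ← map_mul, ← map_inv, ← map_mul, t_conj_inl, rot_of_one]
    simp
  rw [hf] at h
  have hinj : Function.Injective f := by
    refine (FreeGroup.injective_or_isCyclic_range f).resolve_right fun hc => ?_
    obtain ⟨⟨d, _⟩, hd⟩ := hc.exists_generator
    obtain ⟨i, hi⟩ := hd ⟨_, FreeGroup.of 0, rfl⟩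
    obtain ⟨j, hj⟩ := hd ⟨_, FreeGroup.of 1, rfl⟩
    replace hi : d ^ i = f (FreeGroup.of 0) := congrArg Subtype.val hi
    replace hj : d ^ j = f (FreeGroup.of 1) := congrArg Subtype.val hj
    rw [← hi, ← hj, map_zpow, map_zpow] at hU hV
    have h0 : i = 0 := by
      refine eq_zero_of_conj_zpow (a := θ t) (d := d) (fun h1 => h ?_) hU ?_
      · rw [← hi, h1, one_zpow, map_one]
      · rw [hV, ← zpow_neg, ← zpow_add, neg_add_eq_sub]
    rw [← hi, h0, zpow_zero, map_one] at h
    exact h rfl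
  -- Otherwise `θ t` and its square would be conjugators inside the free group, realizing the
  -- forbidden system.
  have ht : (θ t).right ≠ 1 := fun ht => h <|
    eq_one_of_conj (p := θ t) (q := θ t * θ t) ht (by simp [ht]) (right_inl _) hU (by
      rw [← hV, ← hU]; group)
  rw [injective_iff_map_eq_one]
  intro x hx
  have hr : θ (inr x.right) = θ t ^ x.right.toAdd := by
    rw [← map_zpow, t, ← map_zpow, ← ofAdd_zsmul]
    simp
  have hx' : rightHom (θ t) ^ x.right.toAdd = 1 := by
    have := congrArg rightHom hx
    rwa [← inl_left_mul_inr_right x, map_mul, hf, hr, map_mul, rightHom_inl, one_mul, map_zpow,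
      map_one] at this
  have hk : x.right = 1 := (IsMulTorsionFree.zpow_eq_one_iff_right ht).1 hx'
  obtain ⟨n, rfl⟩ := exists_inl_eq hk
  rw [hf, ← map_one inl, inl_inj, ← map_one f] at hx
  rw [hinj hx, map_one]

end FreeByInt

/-! ### Homomorphisms out of `B_3` and `B_4` -/

open FreeByInt SemidirectProduct

theorem eq_one_of_isOfFinOrder {x : BraidGroup 3} (h : IsOfFinOrder x) : x = 1 :=
  (map_eq_one_iff _ equivFreeByInt.injective).1
    (FreeByInt.eq_one_of_isOfFinOrder (equivFreeByInt.toMonoidHom.isOfFinOrder h))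

/-- An endomorphism of `B_3` that does not identify the two generators is injective. -/
theorem injective_of_ne (ξ : BraidGroup 3 →* BraidGroup 3) (h : ξ (σ 0) ≠ ξ (σ 1)) :
    Function.Injective ξ := by
  have := injective_of_ne_one
    (equivFreeByInt.toMonoidHom.comp (ξ.comp equivFreeByInt.symm.toMonoidHom)) (fun h1 => h ?_)
  · intro x y hxy
    have := @this (equivFreeByInt x) (equivFreeByInt y) (by simp [hxy])
    exact equivFreeByInt.injective this
  · have h2 : inl (FreeGroup.of 0) = equivFreeByInt (σ 1 * (σ 0)⁻¹) := by simp
    rw [h2, MonoidHom.comp_apply, MonoidHom.comp_apply] at h1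
    have h3 : ξ (σ 1 * (σ 0)⁻¹) = 1 := by
      simpa only [MulEquiv.coe_toMonoidHom, MulEquiv.symm_apply_apply,
        EmbeddingLike.map_eq_one_iff] using h1
    rw [map_mul, map_inv, mul_inv_eq_one] at h3
    exact h3.symm

theorem σ_four_comm : (σ 0 : BraidGroup 4) * σ 2 = σ 2 * σ 0 := σ_comm 0 2 le_rfl

theorem σ_four_left : (σ 0 : BraidGroup 4) * σ 1 * σ 0 = σ 1 * σ 0 * σ 1 := σ_braid 0 1 rfl

theorem σ_four_right : (σ 1 : BraidGroup 4) * σ 2 * σ 1 = σ 2 * σ 1 * σ 2 := σ_braid 1 2 rfl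

theorem apply_zero_eq_apply_two (φ : BraidGroup 4 →* BraidGroup 3) : φ (σ 0) = φ (σ 2) := by
  refine equivFreeByInt.injective (eq_of_braid (b := equivFreeByInt (φ (σ 1))) ?_ ?_ ?_)
  · simp only [← map_mul, σ_four_comm]
  · simp only [← map_mul, σ_four_left]
  · simp only [← map_mul, σ_four_right]

@[simp] theorem π_zero : π (σ 0) = σ 0 := lift_σ _ _ _ _

@[simp] theorem π_one : π (σ 1) = σ 1 := lift_σ _ _ _ _

@[simp] theorem π_two : π (σ 2) = σ 0 := lift_σ _ _ _ _

@[simp] theorem μ_zero : μ (σ 0) = Equiv.swap 0 1 := lift_σ _ _ _ _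

@[simp] theorem μ_one : μ (σ 1) = Equiv.swap 1 2 := lift_σ _ _ _ _

theorem closure_σ_four : Subgroup.closure {(σ 0 : BraidGroup 4), σ 1, σ 2} = ⊤ := by
  rw [eq_top_iff, ← PresentedGroup.closure_range_of (relators 4), Subgroup.closure_le]
  rintro _ ⟨i, rfl⟩
  refine Subgroup.subset_closure ?_
  fin_cases i
  exacts [Or.inl rfl, Or.inr (Or.inl rfl), Or.inr (Or.inr rfl)]

theorem isCyclicHom_of_eq {G : Type*} [Group G] {φ : BraidGroup 4 →* G} (h1 : φ (σ 0) = φ (σ 1))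
    (h2 : φ (σ 0) = φ (σ 2)) : IsCyclicHom φ := by
  have h : φ.range = Subgroup.zpowers (φ (σ 0)) := by
    rw [MonoidHom.range_eq_map, ← closure_σ_four, MonoidHom.map_closure, Set.image_insert_eq,
      Set.image_pair, ← h1, ← h2, Set.pair_eq_singleton, Set.pair_eq_singleton,
      Subgroup.zpowers_eq_closure]
  rw [IsCyclicHom, h]
  infer_instance

/-- In an infinite group a conjugate of a subgroup may lie properly inside it, so both `g` and `g⁻¹`
are tested. -/
theorem mem_normalizer_closure {G : Type*} [Group G] {s : Set G} {g : G}
    (h1 : ∀ x ∈ s, g * x * g⁻¹ ∈ Subgroup.closure s)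
    (h2 : ∀ x ∈ s, g⁻¹ * x * g ∈ Subgroup.closure s) :
    g ∈ Subgroup.normalizer (Subgroup.closure s : Set G) := by
  have h3 : Subgroup.closure s ≤ (Subgroup.closure s).comap (MulAut.conj g).toMonoidHom :=
    (Subgroup.closure_le _).2 h1
  have h4 : Subgroup.closure s ≤ (Subgroup.closure s).comap (MulAut.conj g⁻¹).toMonoidHom :=
    (Subgroup.closure_le _).2 fun x hx => by simpa using h2 x hx
  refine Subgroup.mem_normalizer_iff.2 fun x => ⟨fun hx => h3 hx, fun hx => ?_⟩
  have := h4 hx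
  simpa [mul_assoc] using this

theorem T_normal : T.Normal := by
  set c : BraidGroup 4 := σ 2 * (σ 0)⁻¹ with hc
  set w : BraidGroup 4 := σ 1 * σ 2 * (σ 0)⁻¹ * (σ 1)⁻¹ with hw
  have hcT : c ∈ T := Subgroup.subset_closure (Or.inr rfl)
  have hwT : w ∈ T := Subgroup.subset_closure (Or.inl rfl)
  have h0c : σ 0 * c * (σ 0)⁻¹ = c := by
    rw [hc, ← mul_assoc, σ_four_comm]
    group
  have h0w : σ 0 * w * (σ 0)⁻¹ = c⁻¹ * w := braid_conj_fst σ_four_left σ_four_right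
  have h1c : σ 1 * c * (σ 1)⁻¹ = w := by
    rw [hc, hw]
    group
  have h1w : σ 1 * w * (σ 1)⁻¹ = w * c⁻¹ * w :=
    braid_conj_snd σ_four_comm σ_four_left σ_four_right
  have h0 : σ 0 ∈ Subgroup.normalizer (T : Set (BraidGroup 4)) := by
    refine mem_normalizer_closure ?_ ?_
    · rintro x (rfl | rfl)
      · exact h0w ▸ mul_mem (inv_mem hcT) hwT
      · exact h0c ▸ hcT
    · have h0c' : (σ 0)⁻¹ * c * σ 0 = c := by
        nth_rw 1 [← h0c]
        group
      rintro x (rfl | rfl)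
      · have : (σ 0)⁻¹ * w * σ 0 = c * w := by
          calc
            _ = c * ((σ 0)⁻¹ * c⁻¹ * σ 0) * ((σ 0)⁻¹ * w * σ 0) := by
              rw [show (σ 0)⁻¹ * c⁻¹ * σ 0 = ((σ 0)⁻¹ * c * σ 0)⁻¹ by group, h0c']; group
            _ = c * ((σ 0)⁻¹ * (c⁻¹ * w) * σ 0) := by group
            _ = c * w := by rw [← h0w]; group
        exact this ▸ mul_mem hcT hwT
      · exact h0c' ▸ hcT
  have h1 : σ 1 ∈ Subgroup.normalizer (T : Set (BraidGroup 4)) := by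
    refine mem_normalizer_closure ?_ ?_
    · rintro x (rfl | rfl)
      · exact h1w ▸ mul_mem (mul_mem hwT (inv_mem hcT)) hwT
      · exact h1c ▸ hwT
    · have h1w' : (σ 1)⁻¹ * w * σ 1 = c := by
        rw [← h1c]
        group
      rintro x (rfl | rfl)
      · exact h1w' ▸ hcT
      · have : (σ 1)⁻¹ * c * σ 1 = c * w⁻¹ * c := by
          have h : w = c * ((σ 1)⁻¹ * c * σ 1)⁻¹ * c := by
            calc
              w = (σ 1)⁻¹ * (σ 1 * w * (σ 1)⁻¹) * σ 1 := by group
              _ = ((σ 1)⁻¹ * w * σ 1) * ((σ 1)⁻¹ * c * σ 1)⁻¹ * ((σ 1)⁻¹ * w * σ 1) := by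
                rw [h1w]; group
              _ = _ := by rw [h1w']
          rw [h]
          group
        exact this ▸ mul_mem (mul_mem hcT (inv_mem hwT)) hcT
  have h2 : σ 2 ∈ Subgroup.normalizer (T : Set (BraidGroup 4)) := by
    -- The third generator needs no further computation, as it differs from `σ 0` by an element of
    -- `T`.
    have : σ 2 = c * σ 0 := by rw [hc]; group
    rw [this]
    exact mul_mem (Subgroup.le_normalizer hcT) h0
  rw [← Subgroup.normalizer_eq_top_iff, eq_top_iff, ← closure_σ_four, Subgroup.closure_le]
  rintro x (rfl | rfl | rfl)
  exacts [h0, h1, h2]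

theorem ker_π : π.ker = T := by
  have := T_normal
  refine le_antisymm ?_ ((Subgroup.closure_le _).2 ?_)
  -- Modulo `T` the outer generators agree, so the quotient map factors through `π`.
  · let s : BraidGroup 3 →* BraidGroup 4 ⧸ T :=
      liftThree (QuotientGroup.mk' T (σ 0)) (QuotientGroup.mk' T (σ 1)) (by
        rw [← map_mul, ← map_mul, σ_four_left, map_mul, map_mul])
    have hs : s.comp π = QuotientGroup.mk' T := by
      refine hom_ext_four (by simp [s]) (by simp [s]) ?_
      have hc : σ 2 * (σ 0)⁻¹ ∈ T := Subgroup.subset_closure (Or.inr rfl)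
      have := (QuotientGroup.eq_one_iff _).2 hc
      rw [QuotientGroup.mk_mul, QuotientGroup.mk_inv, mul_inv_eq_one] at this
      simpa [s] using this.symm
    intro x hx
    rw [MonoidHom.mem_ker] at hx
    rw [← QuotientGroup.ker_mk' T, ← hs, MonoidHom.mem_ker, MonoidHom.comp_apply, hx, map_one]
  · rintro x (rfl | rfl) <;> simp [MonoidHom.mem_ker]

set_option synthInstance.maxHeartbeats 200000 in
set_option synthInstance.maxSize 2000 in
theorem conj_swap_of_braid : ∀ a b c : Equiv.Perm (Fin 3), a * c = c * a →
    a * b * a = b * a * b → b * c * b = c * b * c → (a = b ∧ a = c) ∨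
      ∃ h : Equiv.Perm (Fin 3), Equiv.swap 0 1 = h * a * h⁻¹ ∧ Equiv.swap 1 2 = h * b * h⁻¹ ∧
        Equiv.swap 0 1 = h * c * h⁻¹ := by
  decide +kernel

end ArtinBraid

open ArtinBraid in
theorem theorem3p14 :
    (∀ ψ : ArtinBraid.BraidGroup 4 →* Equiv.Perm (Fin 3),
      ¬ ArtinBraid.IsCyclicHom ψ →
        ArtinBraid.ConjHom ψ (ArtinBraid.μ.comp ArtinBraid.π)) ∧
    (∀ φ : ArtinBraid.BraidGroup 4 →* ArtinBraid.BraidGroup 3,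
      ¬ ArtinBraid.IsIntegralHom φ →
        (∃ ξ : ArtinBraid.BraidGroup 3 →* ArtinBraid.BraidGroup 3,
          Function.Injective ξ ∧
          φ = ξ.comp ArtinBraid.π ∧
          (Function.Surjective φ →
            ∃ e : ArtinBraid.BraidGroup 3 ≃* ArtinBraid.BraidGroup 3,
              e.toMonoidHom = ξ)) ∧
        φ.ker = ArtinBraid.T) := by
  refine ⟨fun ψ hψ => ?_, fun φ hφ => ?_⟩
  · rcases conj_swap_of_braid (ψ (σ 0)) (ψ (σ 1)) (ψ (σ 2))
      (by rw [← map_mul, σ_four_comm, map_mul])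
      (by simp only [← map_mul, σ_four_left]) (by simp only [← map_mul, σ_four_right]) with h | h
    · exact absurd (isCyclicHom_of_eq h.1 h.2) hψ
    · obtain ⟨g, h0, h1, h2⟩ := h
      refine ⟨g, DFunLike.congr_fun (f := μ.comp π)
        (g := (MulAut.conj g).toMonoidHom.comp ψ) (hom_ext_four ?_ ?_ ?_)⟩
      · simpa using h0
      · simpa using h1
      · simpa using h2
  · have h02 := apply_zero_eq_apply_two φ
    -- As `B_3` is torsion free, a cyclic homomorphism into it is integral.
    have hne : φ (σ 0) ≠ φ (σ 1) := fun h01 =>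
      hφ ⟨isCyclicHom_of_eq h01 h02, fun x _ hx => eq_one_of_isOfFinOrder hx⟩
    let ξ : BraidGroup 3 →* BraidGroup 3 :=
      liftThree (φ (σ 0)) (φ (σ 1)) (by simp only [← map_mul, σ_four_left])
    have hξ : φ = ξ.comp π :=
      hom_ext_four (by simp [ξ]) (by simp [ξ]) (by simp [ξ, h02])
    have hinj : Function.Injective ξ := injective_of_ne ξ (by simpa [ξ] using hne)
    refine ⟨⟨ξ, hinj, hξ, fun hs => ?_⟩, ?_⟩
    · have hsurj : Function.Surjective ξ := by
        rw [hξ] at hs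
        exact Function.Surjective.of_comp hs
      exact ⟨MulEquiv.ofBijective ξ ⟨hinj, hsurj⟩, rfl⟩
    · rw [hξ, ← ker_π]
      ext x
      rw [MonoidHom.mem_ker, MonoidHom.mem_ker, MonoidHom.comp_apply, map_eq_one_iff ξ hinj]
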